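/- Let $\Bbbk$ be an algebraically closed field of characteristic zero and let $n\ge 1$. For a primitive $n$-th root of unity $\omega\in\Bbbk$, the Taft algebra $T_{n^2}(\omega)$ is the $\Bbbk$-algebra generated by $g$ and $x$ subject to the relations $g^n=1$, $x^n=0$, $xg=\omega gx$. It is a Hopf algebra with $$\Delta(g)=g\otimes g,\quad \Delta(x)=x\otimes 1+g\otimes x,\quad \varepsilon(g)=1,\quad \varepsilon(x)=0,\quad S(g)=g^{-1},\quad S(x)=-g^{-1}x .$$ Two Hopf algebras $H$ and $H'$ over $\Bbbk$ are called gauge equivalent if there is an invertible element $F\in H\otimes H$ with $(\varepsilon\otimes\mathrm{id})(F)=(\mathrm{id}\otimes\varepsilon)(F)=1$ and $$(1\otimes F)\,(\mathrm{id}\otimes\Delta)(F)\,(\Delta\otimes\mathrm{id})(F^{-1})\,(F^{-1}\otimes 1)=1\otimes 1\otimes 1$$ such that $H'$ is isomorphic as a bialgebra to $H^F$, the algebra $H$ with the same counit and with the comultiplication $\Delta_F(h)=F\Delta(h)F^{-1}$. Let $\omega_1,\omega_2\in\Bbbk$ be primitive $n$-th roots of unity, and let $S_i$ be the antipode of $T_{n^2}(\omega_i)$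 for $i=1,2$. Then $\operatorname{Tr}(S_1)=\operatorname{Tr}(S_2)$ if and only if $\omega_1=\omega_2$. Moreover, $T_{n^2}(\omega_1)$ and $T_{n^2}(\omega_2)$ are gauge equivalent if and only if $\omega_1=\omega_2$. -/

import Mathlib

open scoped TensorProduct

universe u

/-! ## Gauge equivalence of Hopf algebras -/

section Gauge

variable {k H : Type*} [Field k] [Ring H] [HopfAlgebra k H]

/-- A gauge transformation of a Hopf algebra `H`: an invertible `F` in `H ⊗ H` such that
`(ε ⊗ id)(F) = 1` and `(id ⊗ ε)(F) = 1`, where `k ⊗ H` and `H ⊗ k` are identified with `H`. -/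
structure IsGaugeTransformation (F : (H ⊗[k] H)ˣ) : Prop where
  counit_left : TensorProduct.lid k H ((Coalgebra.counit (R := k) (A := H)).rTensor H F.val) = 1
  counit_right : TensorProduct.rid k H ((Coalgebra.counit (R := k) (A := H)).lTensor H F.val) = 1

/-- The element `∂F = (1 ⊗ F) (id ⊗ Δ)(F) (Δ ⊗ id)(F⁻¹) (F⁻¹ ⊗ 1)` of `H ⊗ (H ⊗ H)`. The last two
factors are carried there from `(H ⊗ H) ⊗ H` by the associativity isomorphism. -/
noncomputable def gaugeCoboundary (F : (H ⊗[k] H)ˣ) : H ⊗[k] (H ⊗[k] H) :=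
  ((1 : H) ⊗ₜ[k] F.val)
    * (Coalgebra.comul (R := k) (A := H)).lTensor H F.val
    * TensorProduct.assoc k H H H
        ((Coalgebra.comul (R := k) (A := H)).rTensor H (F⁻¹).val)
    * TensorProduct.assoc k H H H ((F⁻¹).val ⊗ₜ[k] (1 : H))

/-- A 2-cocycle of `H`: a gauge transformation `F` with `∂F = 1 ⊗ 1 ⊗ 1`. -/
structure IsGaugeTwoCocycle (F : (H ⊗[k] H)ˣ) : Prop extends IsGaugeTransformation F where
  coboundary_eq_one : gaugeCoboundary F = 1

/-- The twist `H^F`: on the same algebra `H`, the coalgebra structure with the same counit and with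
the comultiplication `Δ_F(h) = F Δ(h) F⁻¹`. -/
@[reducible]
noncomputable def gaugeTwist (F : (H ⊗[k] H)ˣ) : CoalgebraStruct k H where
  comul := LinearMap.mulLeft k F.val ∘ₗ LinearMap.mulRight k (F⁻¹).val ∘ₗ Coalgebra.comul
  counit := Coalgebra.counit

end Gauge

/-- Two Hopf algebras `H` and `H'` over `k` are gauge equivalent if there is a 2-cocycle `F` of `H`
such that `H'` and the twist `H^F` are isomorphic as bialgebras. -/
def GaugeEquivalent (k H H' : Type*) [Field k] [Ring H] [HopfAlgebra k H]
    [Ring H'] [HopfAlgebra k H'] : Prop :=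
  ∃ F : (H ⊗[k] H)ˣ, IsGaugeTwoCocycle F ∧
    Nonempty (@BialgEquiv k _ H' H _ _ _ _ _ (gaugeTwist F))

/-! ## Taft algebras -/

section Taft

/-- The two generators of a Taft algebra. -/
inductive TaftGen
  | g
  | x

/-- The defining relations `g ^ n = 1`, `x ^ n = 0`, `x g = ω g x` of a Taft algebra. -/
inductive TaftRel {k : Type u} [Field k] (n : ℕ) (ω : k) :
    FreeAlgebra k TaftGen → FreeAlgebra k TaftGen → Prop
  | g_pow : TaftRel n ω (FreeAlgebra.ι k TaftGen.g ^ n) 1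
  | x_pow : TaftRel n ω (FreeAlgebra.ι k TaftGen.x ^ n) 0
  | x_mul_g : TaftRel n ω (FreeAlgebra.ι k TaftGen.x * FreeAlgebra.ι k TaftGen.g)
      (ω • (FreeAlgebra.ι k TaftGen.g * FreeAlgebra.ι k TaftGen.x))

/-- The Taft algebra `T_{n²}(ω)` of a primitive `n`-th root of unity `ω` in `k`: the `k`-algebra
generated by `g` and `x` subject to `g ^ n = 1`, `x ^ n = 0` and `x g = ω g x`. -/
def TaftAlgebra {k : Type u} [Field k] {n : ℕ} {ω : k} (_hω : IsPrimitiveRoot ω n) : Type u :=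
  RingQuot (TaftRel n ω)

namespace TaftAlgebra

variable {k : Type u} [Field k] {n : ℕ} {ω : k} (hω : IsPrimitiveRoot ω n)

noncomputable instance : Ring (TaftAlgebra hω) := inferInstanceAs (Ring (RingQuot (TaftRel n ω)))

noncomputable instance : Algebra k (TaftAlgebra hω) :=
  inferInstanceAs (Algebra k (RingQuot (TaftRel n ω)))

/-- The quotient map from the free algebra. -/
noncomputable def mk : FreeAlgebra k TaftGen →ₐ[k] TaftAlgebra hω :=
  RingQuot.mkAlgHom k (TaftRel n ω)

/-- The generator `g`. -/
noncomputable def g : TaftAlgebra hω := mk hω (FreeAlgebra.ι k TaftGen.g)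

/-- The generator `x`. -/
noncomputable def x : TaftAlgebra hω := mk hω (FreeAlgebra.ι k TaftGen.x)

lemma g_pow : g hω ^ n = 1 := by
  have h : mk hω _ = mk hω _ := RingQuot.mkAlgHom_rel k (TaftRel.g_pow (n := n) (ω := ω))
  simpa [g] using h

lemma x_pow : x hω ^ n = 0 := by
  have h : mk hω _ = mk hω _ := RingQuot.mkAlgHom_rel k (TaftRel.x_pow (n := n) (ω := ω))
  simpa [x] using h

lemma x_mul_g : x hω * g hω = ω • (g hω * x hω) := by
  have h : mk hω _ = mk hω _ := RingQuot.mkAlgHom_rel k (TaftRel.x_mul_g (n := n) (ω := ω))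
  simpa [x, g] using h

section lift

variable {B : Type*} [Ring B] [Algebra k B]

/-- The universal property of the presentation. -/
noncomputable def lift (a b : B) (ha : a ^ n = 1) (hb : b ^ n = 0) (hab : b * a = ω • (a * b)) :
    TaftAlgebra hω →ₐ[k] B :=
  RingQuot.liftAlgHom k (s := TaftRel n ω)
    ⟨FreeAlgebra.lift k (fun i : TaftGen => (TaftGen.rec a b i : B)), by
      intro p q h
      cases h <;> simpa⟩

variable {a b : B} {ha : a ^ n = 1} {hb : b ^ n = 0} {hab : b * a = ω • (a * b)}

@[simp]
lemma lift_g : lift hω a b ha hb hab (g hω) = a := by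
  have h := RingQuot.liftAlgHom_mkAlgHom_apply k
    (FreeAlgebra.lift k (fun i : TaftGen => (TaftGen.rec a b i : B))) (s := TaftRel n ω)
    (by intro p q h; cases h <;> simpa) (FreeAlgebra.ι k TaftGen.g)
  exact h.trans (by simp)

@[simp]
lemma lift_x : lift hω a b ha hb hab (x hω) = b := by
  have h := RingQuot.liftAlgHom_mkAlgHom_apply k
    (FreeAlgebra.lift k (fun i : TaftGen => (TaftGen.rec a b i : B))) (s := TaftRel n ω)
    (by intro p q h; cases h <;> simpa) (FreeAlgebra.ι k TaftGen.x)
  exact h.trans (by simp)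

variable {hω} in
lemma algHom_ext {f f' : TaftAlgebra hω →ₐ[k] B} (hg : f (g hω) = f' (g hω))
    (hx : f (x hω) = f' (x hω)) : f = f' := by
  have h : f.comp (mk hω) = f'.comp (mk hω) := by
    ext i
    cases i
    · exact hg
    · exact hx
  exact RingQuot.ringQuot_ext' k (s := TaftRel n ω) f f' h

end lift

variable {hω} in
/-- Induction on an element: a property that holds for scalars and the generators and is stable
under sums and products holds everywhere. -/
lemma induction {P : TaftAlgebra hω → Prop} (halg : ∀ r, P (algebraMap k _ r)) (hg : P (g hω))
    (hx : P (x hω)) (hmul : ∀ a b, P a → P b → P (a * b)) (hadd : ∀ a b, P a → P b → P (a + b))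
    (a : TaftAlgebra hω) : P a := by
  obtain ⟨p, rfl⟩ : ∃ p, mk hω p = a := RingQuot.mkAlgHom_surjective k (TaftRel n ω) a
  induction p with
  | grade0 r => simpa using halg r
  | grade1 i =>
    cases i
    · exact hg
    · exact hx
  | mul p q hp hq => rw [map_mul]; exact hmul _ _ hp hq
  | add p q hp hq => rw [map_add]; exact hadd _ _ hp hq

/-- Gaussian binomial coefficients evaluated at `ω`, needed for `Δ(x) ^ n = 0`. -/
def gauss (ω : k) : ℕ → ℕ → k
  | _, 0 => 1
  | 0, _ + 1 => 0
  | m + 1, j + 1 => gauss ω m j + ω ^ (j + 1) * gauss ω m (j + 1)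

lemma gauss_aux (ω : k) (m : ℕ) : ∀ j,
    ω ^ j * (ω ^ (j + 1) - 1) * gauss ω m (j + 1) = (ω ^ m - ω ^ j) * gauss ω m j := by
  induction m with
  | zero => intro j; cases j <;> simp [gauss]
  | succ m ih =>
    intro j
    cases j with
    | zero =>
      have := ih 0
      simp only [gauss] at this ⊢
      linear_combination ω * this
    | succ j =>
      have h0 := ih j
      have h1 := ih (j + 1)
      simp only [gauss] at h0 h1 ⊢
      linear_combination ω * h0 + ω * ω ^ (j + 1) * h1

lemma gauss_vanish (hω : IsPrimitiveRoot ω n) {j : ℕ} (hj : j + 1 < n) :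
    gauss ω n (j + 1) = 0 := by
  obtain ⟨m, rfl⟩ : ∃ m, n = m + 1 := ⟨n - 1, by omega⟩
  have h := gauss_aux ω m j
  have h1 : ω ^ (j + 1) - 1 ≠ 0 :=
    sub_ne_zero.mpr (hω.pow_ne_one_of_pos_of_lt (by omega) hj)
  have h2 : (ω ^ (j + 1) - 1) * gauss ω (m + 1) (j + 1) = 0 := by
    have := hω.pow_eq_one
    simp only [gauss]
    linear_combination ω * h + gauss ω m j * this
  exact (mul_eq_zero.mp h2).resolve_left h1

lemma mul_pow_comm {B : Type*} [Ring B] [Algebra k B] {a b : B}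
    (hab : b * a = ω • (a * b)) (j : ℕ) : b * a ^ j = ω ^ j • (a ^ j * b) := by
  induction j with
  | zero => simp
  | succ j ih =>
    rw [pow_succ, ← mul_assoc, ih, smul_mul_assoc, mul_assoc, hab, mul_smul_comm, smul_smul,
      mul_assoc, pow_succ]

lemma add_pow_eq_sum {B : Type*} [Ring B] [Algebra k B] {a b : B}
    (hab : b * a = ω • (a * b)) (m : ℕ) :
    (a + b) ^ m = ∑ p ∈ Finset.HasAntidiagonal.antidiagonal m, gauss ω m p.1 • (a ^ p.1 * b ^ p.2) := by
  have top : ∀ m j, m < j → gauss ω m j = 0 := by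
    intro m
    induction m with
    | zero => intro j hj; cases j <;> simp_all [gauss]
    | succ m ih =>
      intro j hj
      cases j with
      | zero => omega
      | succ j => simp [gauss, ih j (by omega), ih (j + 1) (by omega)]
  induction m with
  | zero => simp [gauss]
  | succ m ih =>
    have hb : b * ∑ p ∈ Finset.HasAntidiagonal.antidiagonal m, gauss ω m p.1 • (a ^ p.1 * b ^ p.2)
        = ∑ p ∈ Finset.HasAntidiagonal.antidiagonal m, (ω ^ p.1 * gauss ω m p.1) • (a ^ p.1 * b ^ (p.2 + 1)) := by
      rw [Finset.mul_sum]
      refine Finset.sum_congr rfl fun p _ => ?_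
      rw [mul_smul_comm, ← mul_assoc, mul_pow_comm hab, smul_mul_assoc, smul_smul, mul_assoc,
        ← pow_succ', mul_comm (gauss ω m p.1)]
    have hb' := Finset.Nat.sum_antidiagonal_succ' (n := m)
      (f := fun p : ℕ × ℕ => (ω ^ p.1 * gauss ω m p.1) • (a ^ p.1 * b ^ p.2))
    have hb'' := Finset.Nat.sum_antidiagonal_succ (n := m)
      (f := fun p : ℕ × ℕ => (ω ^ p.1 * gauss ω m p.1) • (a ^ p.1 * b ^ p.2))
    rw [pow_succ', ih, add_mul, hb, Finset.Nat.sum_antidiagonal_succ]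
    simp only [top m (m + 1) (by omega), mul_zero, zero_smul, zero_add] at hb' hb''
    rw [← hb', hb'', Finset.mul_sum]
    have g0 : ∀ m, gauss ω m 0 = 1 := fun m => by cases m <;> rfl
    simp only [gauss, g0, add_smul, Finset.sum_add_distrib, mul_smul_comm, ← mul_assoc,
      ← pow_succ', pow_zero, one_mul, one_smul]
    abel

lemma add_pow_eq_zero {B : Type*} [Ring B] [Algebra k B] (hω : IsPrimitiveRoot ω n)
    {a b : B} (hab : b * a = ω • (a * b)) (ha : a ^ n = 0) (hb : b ^ n = 0) :
    (a + b) ^ n = 0 := by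
  rw [add_pow_eq_sum hab]
  refine Finset.sum_eq_zero fun p hp => ?_
  obtain ⟨i, j⟩ := p
  rw [Finset.HasAntidiagonal.mem_antidiagonal] at hp
  simp only at hp ⊢
  rcases i with _ | i
  · obtain rfl : j = n := by omega
    simp [hb]
  · rcases j with _ | j
    · obtain rfl : i + 1 = n := by omega
      simp [ha]
    · rw [gauss_vanish hω (by omega), zero_smul]

/-- The comultiplication: `Δ(g) = g ⊗ g` and `Δ(x) = x ⊗ 1 + g ⊗ x`. -/
noncomputable def comulHom : TaftAlgebra hω →ₐ[k] TaftAlgebra hω ⊗[k] TaftAlgebra hω :=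
  lift hω (g hω ⊗ₜ g hω) (x hω ⊗ₜ 1 + g hω ⊗ₜ x hω)
    (by rw [Algebra.TensorProduct.tmul_pow, g_pow, Algebra.TensorProduct.one_def])
    (by
      rw [add_comm]
      refine add_pow_eq_zero hω ?_ ?_ ?_
      · simp [x_mul_g, TensorProduct.smul_tmul']
      · simp [Algebra.TensorProduct.tmul_pow, x_pow]
      · simp [Algebra.TensorProduct.tmul_pow, x_pow])
    (by simp [add_mul, mul_add, x_mul_g, TensorProduct.smul_tmul'])

/-- The counit: `ε(g) = 1` and `ε(x) = 0`. -/
noncomputable def counitHom [NeZero n] : TaftAlgebra hω →ₐ[k] k :=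
  lift hω 1 0 (one_pow n) (zero_pow (NeZero.ne n)) (by simp)

noncomputable instance [NeZero n] : Bialgebra k (TaftAlgebra hω) :=
  Bialgebra.ofAlgHom (comulHom hω) (counitHom hω)
    (algHom_ext (by simp [comulHom])
      (by simp [comulHom, TensorProduct.add_tmul, TensorProduct.tmul_add,
        Algebra.TensorProduct.one_def, add_assoc]))
    (algHom_ext (by simp [comulHom, counitHom]) (by simp [comulHom, counitHom]))
    (algHom_ext (by simp [comulHom, counitHom]) (by simp [comulHom, counitHom]))

lemma comul_g [NeZero n] : Coalgebra.comul (R := k) (g hω) = g hω ⊗ₜ g hω := lift_g hω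

lemma comul_x [NeZero n] :
    Coalgebra.comul (R := k) (x hω) = x hω ⊗ₜ 1 + g hω ⊗ₜ x hω := lift_x hω

lemma counit_g [NeZero n] : Coalgebra.counit (R := k) (g hω) = 1 := lift_g hω

lemma counit_x [NeZero n] : Coalgebra.counit (R := k) (x hω) = 0 := lift_x hω

/-- The inverse of `g`. -/
noncomputable def gInv : TaftAlgebra hω := g hω ^ (n - 1)

lemma gInv_mul_g [NeZero n] : gInv hω * g hω = 1 := by
  rw [gInv, ← pow_succ, Nat.sub_add_cancel (NeZero.one_le), g_pow]

lemma g_mul_gInv [NeZero n] : g hω * gInv hω = 1 := by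
  rw [gInv, ← pow_succ', Nat.sub_add_cancel (NeZero.one_le), g_pow]

lemma gInv_pow : gInv hω ^ n = 1 := by
  rw [gInv, ← pow_mul, mul_comm, pow_mul, g_pow, one_pow]

lemma gInv_mul_x [NeZero n] : gInv hω * x hω = ω • (x hω * gInv hω) := by
  calc gInv hω * x hω = gInv hω * (x hω * g hω) * gInv hω := by
        rw [mul_assoc, mul_assoc, g_mul_gInv, mul_one]
    _ = ω • (gInv hω * g hω * x hω * gInv hω) := by
        rw [x_mul_g, mul_smul_comm, smul_mul_assoc, ← mul_assoc (gInv hω)]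
    _ = _ := by rw [gInv_mul_g, one_mul]

/-- The antipode as an algebra map to the opposite algebra: `S(g) = g⁻¹` and `S(x) = -g⁻¹ x`. -/
noncomputable def antipodeHom [NeZero n] : TaftAlgebra hω →ₐ[k] (TaftAlgebra hω)ᵐᵒᵖ :=
  lift hω (MulOpposite.op (gInv hω)) (MulOpposite.op (-(gInv hω * x hω)))
    (by rw [← MulOpposite.op_pow, gInv_pow, MulOpposite.op_one])
    (by
      have h (m : ℕ) : ∃ c : k, (gInv hω * x hω) ^ m = c • (gInv hω ^ m * x hω ^ m) := by
        have hω0 : ω ≠ 0 := hω.ne_zero (NeZero.ne n)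
        have hc : x hω * gInv hω = ω⁻¹ • (gInv hω * x hω) := by
          rw [gInv_mul_x, smul_smul, inv_mul_cancel₀ hω0, one_smul]
        induction m with
        | zero => exact ⟨1, by simp⟩
        | succ m ih =>
          obtain ⟨c, hm⟩ := ih
          refine ⟨(ω⁻¹) ^ m * c, ?_⟩
          rw [pow_succ', hm, mul_smul_comm, mul_assoc, ← mul_assoc (x hω), mul_pow_comm hc,
            smul_mul_assoc, mul_smul_comm, smul_smul, mul_comm c, mul_assoc, ← pow_succ',
            ← mul_assoc, ← pow_succ']
      obtain ⟨c, hc⟩ := h n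
      rw [← MulOpposite.op_pow, neg_pow, hc, x_pow, mul_zero, smul_zero, mul_zero,
        MulOpposite.op_zero])
    (by
      rw [← MulOpposite.op_mul, ← MulOpposite.op_mul, ← MulOpposite.op_smul]
      congr 1
      rw [mul_neg, neg_mul, smul_neg, mul_assoc (gInv hω), ← mul_smul_comm, ← gInv_mul_x])

/-- The antipode as a linear map. -/
noncomputable def antipodeMap [NeZero n] : TaftAlgebra hω →ₗ[k] TaftAlgebra hω :=
  (MulOpposite.opLinearEquiv k).symm.toLinearMap ∘ₗ (antipodeHom hω).toLinearMap

lemma antipodeMap_mul [NeZero n] (a b : TaftAlgebra hω) :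
    antipodeMap hω (a * b) = antipodeMap hω b * antipodeMap hω a := by
  simp [antipodeMap]

lemma antipodeMap_algebraMap [NeZero n] (r : k) :
    antipodeMap hω (algebraMap k _ r) = algebraMap k _ r := by
  simp [antipodeMap]

lemma antipodeMap_one [NeZero n] : antipodeMap hω 1 = 1 := by
  simpa using antipodeMap_algebraMap hω 1

lemma antipodeMap_g [NeZero n] : antipodeMap hω (g hω) = gInv hω := by
  simp [antipodeMap, antipodeHom]

lemma antipodeMap_x [NeZero n] : antipodeMap hω (x hω) = -(gInv hω * x hω) := by
  simp [antipodeMap, antipodeHom]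

lemma antipode_left [NeZero n] (a : TaftAlgebra hω) :
    LinearMap.mul' k _ ((antipodeMap hω).rTensor _ (Coalgebra.comul (R := k) a)) =
      algebraMap k _ (Coalgebra.counit (R := k) a) := by
  have key (c : k) (X Y : TaftAlgebra hω ⊗[k] TaftAlgebra hω)
      (hX : LinearMap.mul' k _ ((antipodeMap hω).rTensor _ X) = algebraMap k _ c) :
      LinearMap.mul' k _ ((antipodeMap hω).rTensor _ (X * Y)) =
        c • LinearMap.mul' k _ ((antipodeMap hω).rTensor _ Y) := by
    induction Y with
    | zero => simp
    | add Y Z hY hZ => simp only [mul_add, map_add, hY, hZ, smul_add]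
    | tmul b b' =>
      have h : LinearMap.mul' k _ ((antipodeMap hω).rTensor _ (X * b ⊗ₜ[k] b')) =
          antipodeMap hω b * LinearMap.mul' k _ ((antipodeMap hω).rTensor _ X) * b' := by
        clear hX
        induction X with
        | zero => simp
        | add X Z hX hZ => simp only [add_mul, mul_add, map_add, hX, hZ]
        | tmul d d' => simp [antipodeMap_mul, mul_assoc]
      rw [h, hX, ← Algebra.commutes, mul_assoc, ← Algebra.smul_def]
      simp
  induction a using induction with
  | halg r => simp [Algebra.TensorProduct.algebraMap_apply, antipodeMap_algebraMap]
  | hg => simp [comul_g, counit_g, antipodeMap_g, gInv_mul_g]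
  | hx => simp [comul_x, counit_x, antipodeMap_g, antipodeMap_x]
  | hmul a b ha hb =>
    rw [Bialgebra.comul_mul, key _ _ _ ha, hb, Bialgebra.counit_mul, map_mul, Algebra.smul_def]
  | hadd a b ha hb => simp only [map_add, ha, hb]

lemma antipode_right [NeZero n] (a : TaftAlgebra hω) :
    LinearMap.mul' k _ ((antipodeMap hω).lTensor _ (Coalgebra.comul (R := k) a)) =
      algebraMap k _ (Coalgebra.counit (R := k) a) := by
  have key (c : k) (X Y : TaftAlgebra hω ⊗[k] TaftAlgebra hω)
      (hY : LinearMap.mul' k _ ((antipodeMap hω).lTensor _ Y) = algebraMap k _ c) :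
      LinearMap.mul' k _ ((antipodeMap hω).lTensor _ (X * Y)) =
        c • LinearMap.mul' k _ ((antipodeMap hω).lTensor _ X) := by
    induction X with
    | zero => simp
    | add X Z hX hZ => simp only [add_mul, map_add, hX, hZ, smul_add]
    | tmul b b' =>
      have h : LinearMap.mul' k _ ((antipodeMap hω).lTensor _ (b ⊗ₜ[k] b' * Y)) =
          b * LinearMap.mul' k _ ((antipodeMap hω).lTensor _ Y) * antipodeMap hω b' := by
        clear hY
        induction Y with
        | zero => simp
        | add Y Z hY hZ => simp only [add_mul, mul_add, map_add, hY, hZ]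
        | tmul d d' => simp [antipodeMap_mul, mul_assoc]
      rw [h, hY, ← Algebra.commutes, mul_assoc, ← Algebra.smul_def]
      simp
  induction a using induction with
  | halg r => simp [Algebra.TensorProduct.algebraMap_apply, antipodeMap_one]
  | hg => simp [comul_g, counit_g, antipodeMap_g, g_mul_gInv]
  | hx =>
    simp only [comul_x, counit_x, map_add, LinearMap.lTensor_tmul, antipodeMap_x,
      LinearMap.mul'_apply, mul_neg, ← mul_assoc, g_mul_gInv, one_mul, map_zero]
    rw [antipodeMap_one, mul_one, add_neg_cancel]
  | hmul a b ha hb =>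
    rw [Bialgebra.comul_mul, key _ _ _ hb, ha, Bialgebra.counit_mul, mul_comm, map_mul, Algebra.smul_def]
  | hadd a b ha hb => simp only [map_add, ha, hb]

/-- The Taft algebra as a Hopf algebra. -/
noncomputable instance [NeZero n] : HopfAlgebra k (TaftAlgebra hω) where
  antipode := antipodeMap hω
  mul_antipode_rTensor_comul := LinearMap.ext (antipode_left hω)
  mul_antipode_lTensor_comul := LinearMap.ext (antipode_right hω)

end TaftAlgebra

end Taft

/-! ### The antipode of a cocycle twist. -/

section GaugeTwist

open Coalgebra HopfAlgebra

variable {k H : Type*} [Field k] [Ring H] [HopfAlgebra k H]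

/-! Gauge equivalence: for a 2-cocycle `F = ∑ a ⊗ b` with inverse `∑ c ⊗ d`, put `u = ∑ a S(b)` and
`v = ∑ S(c) d`. Then `u v = 1`, and an isomorphism onto the twist turns the antipode into `h ↦ u
S(h) v` (`IsGaugeTwoCocycle.map_antipode`), whose square is `h ↦ u S(v) S²(h) S(u) v`. In a Taft
algebra `S²` is conjugation by `g⁻¹`. The upper triangular representation `toMatrix`, with diagonal
characters `ε` and `χ : g ↦ ω`, sees of this formula at `x` only `ε` of the left factor and `χ` of
the right one. The contributions of `u` and `v` cancel there, so `χ` pulls back to a character with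
`g ↦ ω` (`character_equiv_g`), and the relation `x g = ω' g x`, read in the same matrices, gives `ω'
= ω`.

Trace: in the basis `g⁻ⁱ xʲ` the antipode sends each basis vector to a multiple of another, and the
diagonal entries sum to `∑ ±ωⁱ`. Hence `(1 - ω) Tr S = 2 (1 - ω ^ ⌈n/2⌉)`
(`one_sub_mul_trace_antipode`), from which `ω` can be recovered. -/

variable (k H) in
/-- The linear map `a ⊗ b ↦ a S(b)`. -/
noncomputable def mulAntipodeRight : H ⊗[k] H →ₗ[k] H :=
  LinearMap.mul' k H ∘ₗ (antipode k).lTensor H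

variable (k H) in
/-- The linear map `a ⊗ b ↦ S(a) b`. -/
noncomputable def mulAntipodeLeft : H ⊗[k] H →ₗ[k] H :=
  LinearMap.mul' k H ∘ₗ (antipode k).rTensor H

@[simp]
lemma mulAntipodeRight_tmul (a b : H) : mulAntipodeRight k H (a ⊗ₜ b) = a * antipode k b := by
  simp [mulAntipodeRight]

@[simp]
lemma mulAntipodeLeft_tmul (a b : H) : mulAntipodeLeft k H (a ⊗ₜ b) = antipode k a * b := by
  simp [mulAntipodeLeft]

lemma mulAntipodeRight_comul (h : H) :
    mulAntipodeRight k H (comul (R := k) h) = algebraMap k H (counit (R := k) h) :=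
  mul_antipode_lTensor_comul_apply h

lemma mulAntipodeLeft_comul (h : H) :
    mulAntipodeLeft k H (comul (R := k) h) = algebraMap k H (counit (R := k) h) :=
  mul_antipode_rTensor_comul_apply h

lemma mulAntipodeLeft_mul_tmul (X : H ⊗[k] H) (e d : H) :
    mulAntipodeLeft k H (X * e ⊗ₜ d) = antipode k e * mulAntipodeLeft k H X * d := by
  induction X with
  | zero => simp
  | add X Y hX hY => simp only [add_mul, mul_add, map_add, hX, hY]
  | tmul a b => simp [antipode_mul_antidistrib, mul_assoc]

/-- As `S` reverses products, the factors `S(h₁) h₂ = ε(h)` meet in the middle of `S(e) S(h₁) h₂ d`.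
-/
lemma mulAntipodeLeft_comul_mul (h : H) (G : H ⊗[k] H) :
    mulAntipodeLeft k H (comul (R := k) h * G) = counit (R := k) h • mulAntipodeLeft k H G := by
  induction G with
  | zero => simp
  | add X Y hX hY => simp only [mul_add, map_add, hX, hY, smul_add]
  | tmul e d =>
    rw [mulAntipodeLeft_mul_tmul, mulAntipodeLeft_comul, ← Algebra.commutes, mul_assoc,
      ← Algebra.smul_def, mulAntipodeLeft_tmul]

variable (k H) in
/-- The linear map `a ⊗ (b ⊗ c) ↦ a S(b) c`. -/
noncomputable def mulAntipodeMiddle : H ⊗[k] (H ⊗[k] H) →ₗ[k] H :=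
  LinearMap.mul' k H ∘ₗ (mulAntipodeLeft k H).lTensor H

@[simp]
lemma mulAntipodeMiddle_tmul (a : H) (X : H ⊗[k] H) :
    mulAntipodeMiddle k H (a ⊗ₜ X) = a * mulAntipodeLeft k H X := by
  simp [mulAntipodeMiddle]

/-- For `F = a ⊗ b` and `G = c ⊗ d` the left side is `a c₁ S(c₂) S(b₁) b₂ d`, so the antipode axiom
applies twice. Together with the next lemma this contracts the two sides of the cocycle identity. -/
lemma mulAntipodeMiddle_comul (F G : H ⊗[k] H) :
    mulAntipodeMiddle k H ((comul (R := k) (A := H)).lTensor H F *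
        TensorProduct.assoc k H H H ((comul (R := k) (A := H)).rTensor H G)) =
      TensorProduct.rid k H ((counit (R := k) (A := H)).lTensor H F) *
        TensorProduct.lid k H ((counit (R := k) (A := H)).rTensor H G) := by
  induction F with
  | zero => simp
  | add X Y hX hY => simp only [add_mul, map_add, hX, hY]
  | tmul a b =>
    induction G with
    | zero => simp
    | add X Y hX hY => simp only [mul_add, map_add, hX, hY]
    | tmul c d =>
      have key (X : H ⊗[k] H) : mulAntipodeMiddle k H ((a ⊗ₜ comul (R := k) b) *
          TensorProduct.assoc k H H H (X ⊗ₜ d)) =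
          counit (R := k) b • (a * mulAntipodeRight k H X * d) := by
        induction X with
        | zero => simp
        | add X Y hX hY =>
          simp only [TensorProduct.add_tmul, mul_add, map_add, hX, hY, add_mul, smul_add]
        | tmul e f => simp [mulAntipodeLeft_comul_mul, mul_assoc]
      simp only [LinearMap.lTensor_tmul, LinearMap.rTensor_tmul, key, mulAntipodeRight_comul,
        TensorProduct.rid_tmul, TensorProduct.lid_tmul, Algebra.algebraMap_eq_smul_one,
        mul_smul_comm, smul_mul_assoc, mul_one]
      exact smul_comm _ _ _

lemma mulAntipodeMiddle_one_tmul_mul (F G : H ⊗[k] H) :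
    mulAntipodeMiddle k H (((1 : H) ⊗ₜ[k] G) * TensorProduct.assoc k H H H (F ⊗ₜ (1 : H))) =
      mulAntipodeRight k H F * mulAntipodeLeft k H G := by
  induction F with
  | zero => simp
  | add X Y hX hY => simp only [TensorProduct.add_tmul, mul_add, map_add, hX, hY, add_mul]
  | tmul a b => simp [mulAntipodeLeft_mul_tmul, mul_assoc]

/-- For a 2-cocycle `F = ∑ a ⊗ b` with inverse `∑ c ⊗ d`, the element `∑ S(c) d` is a right inverse
of `∑ a S(b)`. -/
lemma IsGaugeTwoCocycle.mulAntipode_mul_mulAntipode {F : (H ⊗[k] H)ˣ} (hF : IsGaugeTwoCocycle F) :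
    mulAntipodeRight k H F.val * mulAntipodeLeft k H (F⁻¹).val = 1 := by
  have hassoc (X Y : (H ⊗[k] H) ⊗[k] H) : TensorProduct.assoc k H H H (X * Y) =
      TensorProduct.assoc k H H H X * TensorProduct.assoc k H H H Y :=
    map_mul (Algebra.TensorProduct.assoc k k k H H H) X Y
  have h1 : ((1 : H) ⊗ₜ[k] (F⁻¹).val) * ((1 : H) ⊗ₜ[k] F.val) = 1 := by
    simp [Algebra.TensorProduct.one_def]
  have h2 : TensorProduct.assoc k H H H ((F⁻¹).val ⊗ₜ[k] (1 : H)) *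
      TensorProduct.assoc k H H H (F.val ⊗ₜ[k] (1 : H)) = 1 := by
    rw [← hassoc]
    simp [Algebra.TensorProduct.one_def]
  -- Cancelling the outer factors rewrites the cocycle condition as `(id ⊗ Δ)(F) (Δ ⊗ id)(F⁻¹) = (1
  -- ⊗ F⁻¹) (F ⊗ 1)`.
  have h3 := congrArg (fun Z => ((1 : H) ⊗ₜ[k] (F⁻¹).val) * Z *
    TensorProduct.assoc k H H H (F.val ⊗ₜ[k] (1 : H))) hF.coboundary_eq_one
  simp only [gaugeCoboundary, mul_one] at h3
  simp only [mul_assoc] at h3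
  rw [h2, mul_one, ← mul_assoc, h1, one_mul] at h3
  have h4 := congrArg (mulAntipodeMiddle k H) h3
  rw [mulAntipodeMiddle_comul, mulAntipodeMiddle_one_tmul_mul, hF.counit_right, one_mul] at h4
  rw [← h4]
  -- Since `ε ⊗ id` is multiplicative, the normalisation of `F` passes to `F⁻¹`.
  let E : H ⊗[k] H →ₐ[k] H := (Algebra.TensorProduct.lid k H).toAlgHom.comp
    (Algebra.TensorProduct.map (Bialgebra.counitAlgHom k H) (AlgHom.id k H))
  have hE (X : H ⊗[k] H) :
      E X = TensorProduct.lid k H ((counit (R := k) (A := H)).rTensor H X) := rfl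
  have h5 : E F.val * E (F⁻¹).val = 1 := by rw [← map_mul, Units.mul_inv, map_one]
  rwa [hE, hE, hF.counit_left, one_mul] at h5

/-- The antipode `h ↦ u S(h) v` of the twist `H^F`, where `u = ∑ a S(b)` for `F = ∑ a ⊗ b` and
`v = ∑ S(c) d` for `F⁻¹ = ∑ c ⊗ d`. -/
noncomputable def gaugeTwistAntipode (F : (H ⊗[k] H)ˣ) : H →ₗ[k] H :=
  LinearMap.mulLeft k (mulAntipodeRight k H F.val) ∘ₗ
    LinearMap.mulRight k (mulAntipodeLeft k H (F⁻¹).val) ∘ₗ antipode k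

lemma gaugeTwistAntipode_apply (F : (H ⊗[k] H)ˣ) (h : H) : gaugeTwistAntipode F h =
    mulAntipodeRight k H F.val * antipode k h * mulAntipodeLeft k H (F⁻¹).val := by
  simp [gaugeTwistAntipode, mul_assoc]

/-- For `Y = p ⊗ q` the left side is `u S(p) (∑ S(a) v b) q`, and `∑ S(a) v b = ∑ S(c a) d b` is the
contraction of `F⁻¹ F = 1`. -/
lemma mul_rTensor_gaugeTwistAntipode (F : (H ⊗[k] H)ˣ) (Y : H ⊗[k] H) :
    LinearMap.mul' k H ((gaugeTwistAntipode F).rTensor H (F.val * Y)) =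
      mulAntipodeRight k H F.val * mulAntipodeLeft k H Y := by
  induction Y with
  | zero => simp
  | add X Y hX hY => simp only [mul_add, map_add, hX, hY]
  | tmul p q =>
    have key (X : H ⊗[k] H) :
        LinearMap.mul' k H ((gaugeTwistAntipode F).rTensor H (X * p ⊗ₜ q)) =
          mulAntipodeRight k H F.val * antipode k p *
            mulAntipodeLeft k H ((F⁻¹).val * X) * q := by
      induction X with
      | zero => simp
      | add X Y hX hY => simp only [add_mul, mul_add, map_add, hX, hY]
      | tmul a b =>
        simp [gaugeTwistAntipode_apply, antipode_mul_antidistrib, mulAntipodeLeft_mul_tmul,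
          mul_assoc]
    rw [key, Units.inv_mul, Algebra.TensorProduct.one_def]
    simp [mul_assoc]

lemma IsGaugeTwoCocycle.mul_rTensor_gaugeTwistAntipode_comul {F : (H ⊗[k] H)ˣ}
    (hF : IsGaugeTwoCocycle F) (h : H) :
    LinearMap.mul' k H ((gaugeTwistAntipode F).rTensor H
      (F.val * (comul (R := k) h * (F⁻¹).val))) = algebraMap k H (counit (R := k) h) := by
  rw [mul_rTensor_gaugeTwistAntipode, mulAntipodeLeft_comul_mul, mul_smul_comm,
    hF.mulAntipode_mul_mulAntipode, Algebra.algebraMap_eq_smul_one]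

/-- A bialgebra isomorphism onto a twist carries the antipode to `gaugeTwistAntipode`. -/
lemma IsGaugeTwoCocycle.map_antipode {H' : Type*} [Ring H'] [HopfAlgebra k H'] {F : (H ⊗[k] H)ˣ}
    (hF : IsGaugeTwoCocycle F) (φ : H' ≃ₐ[k] H)
    (hcounit : ∀ h, counit (R := k) (φ h) = counit (R := k) h)
    (hcomul : ∀ h, TensorProduct.map φ.toLinearMap φ.toLinearMap (comul (R := k) h) =
      F.val * (comul (R := k) (φ h) * (F⁻¹).val)) (h : H') :
    φ (antipode k h) = gaugeTwistAntipode F (φ h) := by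
  let T : H' →ₗ[k] H' := φ.symm.toLinearMap ∘ₗ gaugeTwistAntipode F ∘ₗ φ.toLinearMap
  -- The transported map is a left convolution inverse of the identity, and the antipode is a right
  -- one, so they agree.
  have hT : WithConv.toConv T * WithConv.toConv LinearMap.id = 1 := by
    ext h
    rw [LinearMap.convMul_apply, LinearMap.convOne_apply]
    apply φ.injective
    have key (X : H' ⊗[k] H') : φ (LinearMap.mul' k H' (TensorProduct.map T LinearMap.id X)) =
        LinearMap.mul' k H ((gaugeTwistAntipode F).rTensor H
          (TensorProduct.map φ.toLinearMap φ.toLinearMap X)) := by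
      induction X with
      | zero => simp
      | add X Y hX hY => simp only [map_add, hX, hY]
      | tmul a b => simp [T]
    refine (key _).trans ?_
    rw [hcomul, hF.mul_rTensor_gaugeTwistAntipode_comul, hcounit, AlgEquiv.commutes]
  have h1 : WithConv.toConv T = WithConv.toConv (antipode k) :=
    left_inv_eq_right_inv hT LinearMap.id_mul_antipode
  have h2 : T = antipode k := WithConv.toConv_injective h1
  rw [← h2]
  simp [T]

/-- A character `χ` with `χ ∘ S² = χ` takes the value `1` on `u S(v)`, where `u = ∑ a S(b)` for
`F = ∑ a ⊗ b` and `v = ∑ S(c) d` for `F⁻¹ = ∑ c ⊗ d`. -/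
lemma map_mulAntipodeRight_mul_map_antipode (F : (H ⊗[k] H)ˣ) (χ : H →ₐ[k] k)
    (hχ : ∀ h, χ (antipode k (antipode k h)) = χ h) :
    χ (mulAntipodeRight k H F.val) * χ (antipode k (mulAntipodeLeft k H (F⁻¹).val)) = 1 := by
  obtain ⟨χ', hχ'⟩ : ∃ χ' : H →ₐ[k] k, ∀ h, χ' h = χ (antipode k h) :=
    ⟨AlgHom.ofLinearMap (χ.toLinearMap ∘ₗ antipode k) (by simp)
      (fun a b => by simp [antipode_mul_antidistrib, mul_comm]), fun _ => rfl⟩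
  -- `Ψ = χ ⊗ (χ ∘ S)` takes the value `χ(u)` on `F`. On `F⁻¹` it takes the value `χ(S(v))`, because
  -- `S(S(c) d) = S(d) S²(c)` and `χ ∘ S² = χ`.
  let Ψ : H ⊗[k] H →ₐ[k] k := Algebra.TensorProduct.lift χ χ' (fun _ _ => Commute.all _ _)
  have h1 (X : H ⊗[k] H) : χ (mulAntipodeRight k H X) = Ψ X := by
    induction X with
    | zero => simp
    | add X Y hX hY => simp only [map_add, hX, hY]
    | tmul a b => simp [Ψ, hχ']
  have h2 (X : H ⊗[k] H) : χ (antipode k (mulAntipodeLeft k H X)) = Ψ X := by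
    induction X with
    | zero => simp
    | add X Y hX hY => simp only [map_add, hX, hY]
    | tmul a b => simp [Ψ, hχ', antipode_mul_antidistrib, hχ, mul_comm]
  rw [h1, h2, ← map_mul, Units.mul_inv, map_one]

end GaugeTwist

/-! ### The trivial twist and auxiliary facts. -/

lemma GaugeEquivalent.refl (k H : Type*) [Field k] [Ring H] [HopfAlgebra k H] :
    GaugeEquivalent k H H := by
  have h : gaugeTwist (1 : (H ⊗[k] H)ˣ) = (inferInstance : CoalgebraStruct k H) := by
    simp only [gaugeTwist]
    congr 1
    ext
    simp
  refine ⟨1, ⟨⟨by simp [Algebra.TensorProduct.one_def],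
    by simp [Algebra.TensorProduct.one_def]⟩, ?_⟩, ?_⟩
  · simp [gaugeCoboundary, Algebra.TensorProduct.one_def]
  · rw [h]
    exact ⟨BialgEquiv.refl k H⟩

-- Turns the isomorphism into explicit equations, so that the twisted coalgebra structure need not
-- compete with the standard instance on the same algebra.
open Coalgebra in
lemma exists_algEquiv_of_bialgEquiv {k A B : Type*} [CommSemiring k] [Semiring A] [Semiring B]
    [Algebra k A] [Algebra k B] [CoalgebraStruct k A] [CoalgebraStruct k B] (e : A ≃ₐc[k] B) :
    ∃ φ : A ≃ₐ[k] B, (∀ h, counit (R := k) (φ h) = counit (R := k) h) ∧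
      ∀ h, TensorProduct.map φ.toLinearMap φ.toLinearMap (comul (R := k) h) =
        comul (R := k) (φ h) :=
  ⟨AlgEquiv.ofLinearEquiv e.toCoalgEquiv.toLinearEquiv (map_one e.toMulEquiv)
      (map_mul e.toMulEquiv),
    fun h => congrArg (fun f => f h) e.toCoalgEquiv.counit_comp,
    fun h => congrArg (fun f => f h) e.toCoalgEquiv.map_comp_comul⟩

/-- The representative `val` may wrap around from `n - 1` to `0`, which `ζ ^ n = 1` absorbs. -/
lemma IsPrimitiveRoot.pow_zmod_val_add_one {k : Type*} [Field k] {n : ℕ} [NeZero n]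
    {ζ : k} (hζ : IsPrimitiveRoot ζ n) (i : ZMod n) : ζ ^ (i + 1).val = ζ ^ i.val * ζ := by
  rw [← pow_succ, ← pow_mod_orderOf ζ (i + 1).val, ← pow_mod_orderOf ζ (i.val + 1),
    ← hζ.eq_orderOf, ← ZMod.val_natCast, ← ZMod.val_natCast]
  simp

/-! ### The square of the antipode and the gauge invariance of `ω`. -/

namespace TaftAlgebra

open Coalgebra HopfAlgebra

variable {k : Type u} [Field k] {n : ℕ} {ω : k} (hω : IsPrimitiveRoot ω n)

lemma antipode_eq [NeZero n] : antipode k (A := TaftAlgebra hω) = antipodeMap hω := rfl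

lemma antipode_g [NeZero n] : antipode k (g hω) = gInv hω := antipodeMap_g hω

lemma antipode_x [NeZero n] : antipode k (x hω) = -(gInv hω * x hω) := antipodeMap_x hω

lemma antipode_gInv [NeZero n] : antipode k (gInv hω) = g hω := by
  have h : antipode k (gInv hω) * antipode k (g hω) = 1 := by
    rw [← antipode_mul_antidistrib, g_mul_gInv, antipode_one]
  rw [antipode_g] at h
  exact left_inv_eq_right_inv h (gInv_mul_g hω)

/-- The square of the antipode is conjugation by `g⁻¹`. -/
lemma antipode_antipode [NeZero n] (h : TaftAlgebra hω) :
    antipode k (antipode k h) = gInv hω * h * g hω := by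
  induction h using induction with
  | halg r =>
    rw [antipode_eq, antipodeMap_algebraMap, antipodeMap_algebraMap, ← Algebra.commutes,
      mul_assoc, gInv_mul_g, mul_one]
  | hg => rw [antipode_g, antipode_gInv, gInv_mul_g, one_mul]
  | hx =>
    rw [antipode_x, map_neg, antipode_mul_antidistrib, antipode_gInv, antipode_x, neg_mul, neg_neg]
  | hmul a b ha hb =>
    rw [antipode_mul_antidistrib, antipode_mul_antidistrib, ha, hb]
    calc gInv hω * a * g hω * (gInv hω * b * g hω)
        = gInv hω * a * (g hω * gInv hω) * b * g hω := by simp only [mul_assoc]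
      _ = _ := by rw [g_mul_gInv, mul_one, mul_assoc (gInv hω) a b]
  | hadd a b ha hb => simp only [map_add, ha, hb, mul_add, add_mul]

/-- The algebra map `T_{n²}(ω) → M₂(k)` with `g ↦ diag(1, ω)` and `x ↦ E₁₂`. -/
noncomputable def toMatrix (hn : 2 ≤ n) : TaftAlgebra hω →ₐ[k] Matrix (Fin 2) (Fin 2) k :=
  lift hω (Matrix.diagonal ![1, ω]) !![0, 1; 0, 0]
    (by
      rw [Matrix.diagonal_pow, ← Matrix.diagonal_one]
      congr 1
      ext i
      fin_cases i <;> simp [hω.pow_eq_one])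
    (by
      obtain ⟨m, rfl⟩ := Nat.exists_eq_add_of_le hn
      have h : (!![0, 1; 0, 0] : Matrix (Fin 2) (Fin 2) k) ^ 2 = 0 := by
        ext i j
        fin_cases i <;> fin_cases j <;> simp [pow_two]
      rw [pow_add, h, zero_mul])
    (by
      ext i j
      fin_cases i <;> fin_cases j <;> simp [Matrix.mul_apply, Fin.sum_univ_two])

section toMatrix

variable (hn : 2 ≤ n)

lemma toMatrix_g : toMatrix hω hn (g hω) = Matrix.diagonal ![1, ω] := lift_g hω

lemma toMatrix_x : toMatrix hω hn (x hω) = !![0, 1; 0, 0] := lift_x hω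

lemma toMatrix_apply_one_zero (h : TaftAlgebra hω) : toMatrix hω hn h 1 0 = 0 := by
  induction h using induction with
  | halg r => simp [Matrix.algebraMap_matrix_apply]
  | hg => simp [toMatrix_g]
  | hx => simp [toMatrix_x]
  | hmul a b ha hb => simp [Matrix.mul_apply, Fin.sum_univ_two, ha, hb]
  | hadd a b ha hb => simp [ha, hb]

lemma toMatrix_apply_zero_zero [NeZero n] (h : TaftAlgebra hω) :
    toMatrix hω hn h 0 0 = counit (R := k) h := by
  induction h using induction with
  | halg r => simp [Matrix.algebraMap_matrix_apply]
  | hg => simp [toMatrix_g, counit_g]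
  | hx => simp [toMatrix_x, counit_x]
  | hmul a b ha hb => simp [Matrix.mul_apply, Fin.sum_univ_two, toMatrix_apply_one_zero, ha, hb]
  | hadd a b ha hb => simp [ha, hb]

/-- The character of `T_{n²}(ω)` with `g ↦ ω` and `x ↦ 0`. -/
noncomputable def character [NeZero n] : TaftAlgebra hω →ₐ[k] k :=
  lift hω ω 0 hω.pow_eq_one (zero_pow (NeZero.ne n)) (by simp)

lemma character_g [NeZero n] : character hω (g hω) = ω := lift_g hω

lemma character_x [NeZero n] : character hω (x hω) = 0 := lift_x hω

lemma toMatrix_apply_one_one [NeZero n] (h : TaftAlgebra hω) :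
    toMatrix hω hn h 1 1 = character hω h := by
  induction h using induction with
  | halg r => simp [Matrix.algebraMap_matrix_apply]
  | hg => simp [toMatrix_g, character_g]
  | hx => simp [toMatrix_x, character_x]
  | hmul a b ha hb => simp [Matrix.mul_apply, Fin.sum_univ_two, toMatrix_apply_one_zero, ha, hb]
  | hadd a b ha hb => simp [ha, hb]

lemma toMatrix_mul_apply_zero_one [NeZero n] (a b : TaftAlgebra hω) :
    toMatrix hω hn (a * b) 0 1 =
      counit (R := k) a * toMatrix hω hn b 0 1 + toMatrix hω hn a 0 1 * character hω b := by
  simp [Matrix.mul_apply, Fin.sum_univ_two, toMatrix_apply_zero_zero, toMatrix_apply_one_one]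

/-- The matrix of `x` has zero diagonal, so the unknown off-diagonal entries of `a` and `b` drop
out. -/
lemma toMatrix_mul_x_mul_apply_zero_one [NeZero n] (a b : TaftAlgebra hω) :
    toMatrix hω hn (a * x hω * b) 0 1 = counit (R := k) a * character hω b := by
  simp [toMatrix_mul_apply_zero_one, counit_x, toMatrix_x, character_x]

end toMatrix

lemma counit_gInv [NeZero n] : counit (R := k) (gInv hω) = 1 := by
  simp [gInv, counit_g]

lemma character_antipode_antipode [NeZero n] (h : TaftAlgebra hω) :
    character hω (antipode k (antipode k h)) = character hω h := by
  rw [antipode_antipode, map_mul, map_mul, mul_right_comm, ← map_mul, gInv_mul_g, map_one, one_mul]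

variable {ω' : k} {hω} {hω' : IsPrimitiveRoot ω' n}

/-- If the square of the antipode of `T_{n²}(ω')` corresponds to that of a twist of `T_{n²}(ω)`
under an algebra isomorphism that preserves the counit, then the character `g ↦ ω` pulls back to
`g ↦ ω`. -/
lemma character_equiv_g [NeZero n] (hn : 2 ≤ n) {F : (TaftAlgebra hω ⊗[k] TaftAlgebra hω)ˣ}
    (hF : IsGaugeTwoCocycle F) (φ : TaftAlgebra hω' ≃ₐ[k] TaftAlgebra hω)
    (hcounit : ∀ h, counit (R := k) (φ h) = counit (R := k) h)
    (hφ : ∀ h, φ (antipode k h) = gaugeTwistAntipode F (φ h)) :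
    character hω (φ (g hω')) = ω := by
  set uu := mulAntipodeRight k _ F.val with huu
  set vv := mulAntipodeLeft k _ (F⁻¹).val with hvv
  have huv : uu * vv = 1 := hF.mulAntipode_mul_mulAntipode
  have hχ : character hω uu * character hω (antipode k vv) = 1 :=
    map_mulAntipodeRight_mul_map_antipode F _ (character_antipode_antipode hω)
  have hε : counit (R := k) uu * counit (R := k) (antipode k vv) = 1 := by
    rw [counit_antipode, ← Bialgebra.counit_mul, huv, Bialgebra.counit_one]
  have hχ' : character hω (antipode k uu) * character hω vv = 1 := by
    have h1 : character hω uu * character hω vv = 1 := by rw [← map_mul, huv, map_one]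
    have h2 : character hω (antipode k vv) * character hω (antipode k uu) = 1 := by
      rw [← map_mul, ← antipode_mul_antidistrib, huv, antipode_one, map_one]
    -- `χ(u)` and `χ(S(u))` are both inverse to the scalar `χ(S(v))`, so `χ(S(u))` can replace
    -- `χ(u)` in `h1`.
    linear_combination character hω vv * character hω uu * h2 + h1 -
      character hω (antipode k uu) * character hω vv * hχ
  -- Both sides are the square of the twisted antipode at `x`: the left by transport from
  -- `T_{n²}(ω')`, the right by the formula with `u` and `v`.
  have hsq : φ (gInv hω') * x hω * φ (g hω') =
      (uu * antipode k vv * gInv hω) * x hω * (g hω * antipode k uu * vv) := by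
    have h1 := hφ (antipode k (φ.symm (x hω)))
    rw [antipode_antipode, hφ, map_mul, map_mul, AlgEquiv.apply_symm_apply,
      gaugeTwistAntipode_apply, gaugeTwistAntipode_apply, ← huu, ← hvv, antipode_mul_antidistrib,
      antipode_mul_antidistrib, antipode_antipode] at h1
    rw [h1]
    simp only [mul_assoc]
  have h2 := congrArg (fun y => toMatrix hω hn y 0 1) hsq
  simp only [toMatrix_mul_x_mul_apply_zero_one, hcounit, Bialgebra.counit_mul, counit_gInv,
    one_mul, mul_one, map_mul, character_g] at h2
  rw [hε, one_mul, mul_assoc, hχ', mul_one] at h2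
  exact h2

lemma eq_of_character_equiv_g [NeZero n] (hn : 2 ≤ n)
    (φ : TaftAlgebra hω' ≃ₐ[k] TaftAlgebra hω)
    (hcounit : ∀ h, counit (R := k) (φ h) = counit (R := k) h)
    (hφ : character hω (φ (g hω')) = ω) : ω' = ω := by
  have hx1 : character hω (φ (x hω')) = 0 := by
    have : character hω (φ (x hω')) ^ n = 0 := by rw [← map_pow, ← map_pow, x_pow]; simp
    exact pow_eq_zero_iff (NeZero.ne n) |>.mp this
  have hrel := congrArg (fun y => toMatrix hω hn (φ y) 0 1) (x_mul_g hω')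
  simp only [map_mul, map_smul, Matrix.smul_apply] at hrel
  simp only [← map_mul (toMatrix hω hn), toMatrix_mul_apply_zero_one, hcounit, counit_x, counit_g,
    hφ, hx1, zero_mul, one_mul, mul_zero, zero_add, add_zero, smul_eq_mul] at hrel
  rw [mul_comm] at hrel
  refine (mul_right_cancel₀ ?_ hrel).symm
  -- If this entry vanished, the pulled back representation would kill the generator `x` of
  -- `T_{n²}(ω')`. Its image would then commute with the image of `g`, whereas commuting with the
  -- matrix of `x` in `T_{n²}(ω)` forces `ω = 1`.
  intro h0
  have hX : toMatrix hω hn (φ (x hω')) = 0 := by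
    ext i j
    fin_cases i <;> fin_cases j
    · simp [toMatrix_apply_zero_zero, hcounit, counit_x]
    · exact h0
    · exact toMatrix_apply_one_zero hω hn _
    · simp [toMatrix_apply_one_one, hx1]
  have hcomm (h : TaftAlgebra hω') :
      Commute (toMatrix hω hn (φ h)) (toMatrix hω hn (φ (g hω'))) := by
    induction h using induction with
    | halg r => simpa using Algebra.commute_algebraMap_left r _
    | hg => exact Commute.refl _
    | hx => rw [hX]; exact Commute.zero_left _
    | hmul a b ha hb => rw [map_mul, map_mul]; exact ha.mul_left hb
    | hadd a b ha hb => rw [map_add, map_add]; exact ha.add_left hb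
  have h1 := hcomm (φ.symm (x hω))
  rw [AlgEquiv.apply_symm_apply] at h1
  have h2 := congrArg (fun M => M 0 1) h1.eq
  simp only [← map_mul, toMatrix_mul_apply_zero_one] at h2
  simp [hcounit, counit_x, counit_g, character_x, hφ, toMatrix_x] at h2
  exact hω.ne_one (by omega) h2

/-- Gauge equivalent Taft algebras of the same dimension have the same root of unity. -/
lemma eq_of_gaugeEquivalent [NeZero n]
    (h : GaugeEquivalent k (TaftAlgebra hω) (TaftAlgebra hω')) : ω = ω' := by
  obtain hn | hn : n = 1 ∨ 2 ≤ n := by have := NeZero.ne n; omega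
  -- The matrix representation needs `E₁₂ ^ n = 0`, which fails for `n = 1`.
  · subst hn
    rw [IsPrimitiveRoot.one_right_iff] at hω hω'
    rw [hω, hω']
  obtain ⟨F, hF, ⟨e⟩⟩ := h
  obtain ⟨φ, hcounit, hcomul⟩ := @exists_algEquiv_of_bialgEquiv _ _ _ _ _ _ _ _ _ (gaugeTwist F) e
  have hcomul' (h : TaftAlgebra hω') :
      TensorProduct.map φ.toLinearMap φ.toLinearMap (comul (R := k) h) =
        F.val * (comul (R := k) (φ h) * (F⁻¹).val) := hcomul h
  exact (eq_of_character_equiv_g hn φ hcounit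
    (character_equiv_g hn hF φ hcounit (hF.map_antipode φ hcounit hcomul'))).symm

variable (hω)

/-! ### The monomial basis. -/

section Basis

/-- The action of `g` on functions on `ℤ/n × {0, …, n - 1}`: the regular representation in terms
of the basis `g⁻ⁱ xʲ`. -/
def regularG : Module.End k (ZMod n × Fin n → k) where
  toFun f p := f (p.1 + 1, p.2)
  map_add' _ _ := rfl
  map_smul' _ _ := rfl

/-- The action of `x` on functions on `ℤ/n × {0, …, n - 1}`: the regular representation in terms
of the basis `g⁻ⁱ xʲ`. -/
def regularX (n : ℕ) (ω : k) : Module.End k (ZMod n × Fin n → k) where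
  toFun f p := if h : (p.2 : ℕ) = 0 then 0 else
    (ω⁻¹) ^ p.1.val * f (p.1, ⟨p.2 - 1, by omega⟩)
  map_add' _ _ := by ext p; by_cases h : (p.2 : ℕ) = 0 <;> simp [h, mul_add]
  map_smul' _ _ := by ext p; by_cases h : (p.2 : ℕ) = 0 <;> simp [h, mul_left_comm]

lemma regularG_apply (f : ZMod n × Fin n → k) (p) : regularG f p = f (p.1 + 1, p.2) := rfl

lemma regularG_pow_apply (m : ℕ) (f : ZMod n × Fin n → k) (p) :
    (regularG ^ m) f p = f (p.1 + m, p.2) := by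
  induction m generalizing f with
  | zero => simp
  | succ m ih =>
    rw [pow_succ, Module.End.mul_apply, ih, regularG_apply]
    simp [add_assoc]

lemma regularX_apply (f : ZMod n × Fin n → k) (p) : regularX n ω f p =
    if h : (p.2 : ℕ) = 0 then 0 else (ω⁻¹) ^ p.1.val * f (p.1, ⟨p.2 - 1, by omega⟩) := rfl

lemma regularX_pow_apply_eq_zero (m : ℕ) (f : ZMod n × Fin n → k) (p) (hp : (p.2 : ℕ) < m) :
    (regularX n ω ^ m) f p = 0 := by
  induction m generalizing p with
  | zero => omega
  | succ m ih =>
    rw [pow_succ', Module.End.mul_apply, regularX_apply]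
    split_ifs with h
    · rfl
    · rw [ih _ (by simp; omega), mul_zero]

/-- The regular representation in terms of the basis `g⁻ⁱ xʲ`. -/
noncomputable def regular [NeZero n] : TaftAlgebra hω →ₐ[k] Module.End k (ZMod n × Fin n → k) :=
  lift hω regularG (regularX n ω)
    (LinearMap.ext fun f => funext fun p => by simp [regularG_pow_apply])
    (LinearMap.ext fun f => funext fun p => regularX_pow_apply_eq_zero n f p p.2.2)
    (LinearMap.ext fun f => funext fun p => by
      have hω0 : ω ≠ 0 := hω.ne_zero (NeZero.ne n)
      simp only [Module.End.mul_apply, LinearMap.smul_apply, Pi.smul_apply, smul_eq_mul,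
        regularX_apply, regularG_apply]
      split_ifs with h
      · simp
      · rw [hω.inv.pow_zmod_val_add_one]
        field_simp)

lemma regular_g [NeZero n] : regular hω (g hω) = regularG := lift_g hω

lemma regular_x [NeZero n] : regular hω (x hω) = regularX n ω := lift_x hω

lemma regular_gInv_pow_single [NeZero n] (m : ℕ) (i : ZMod n) (j : Fin n) :
    regular hω (gInv hω ^ m) (Pi.single (i, j) 1) = Pi.single (i + m, j) 1 := by
  rw [gInv, ← pow_mul, map_pow, regular_g]
  ext p
  rw [regularG_pow_apply, Pi.single_apply, Pi.single_apply]
  congr 1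
  have h : (((n - 1) * m : ℕ) : ZMod n) = -m := by
    rw [Nat.cast_mul, Nat.cast_sub NeZero.one_le]
    simp
  rw [h, Prod.ext_iff, Prod.ext_iff, ← sub_eq_add_neg, sub_eq_iff_eq_add]

lemma regular_x_pow_single [NeZero n] (j : ℕ) (hj : j < n) :
    regular hω (x hω ^ j) (Pi.single (0, 0) 1) = Pi.single (0, ⟨j, hj⟩) 1 := by
  induction j with
  | zero => simp
  | succ j ih =>
    rw [pow_succ', map_mul, Module.End.mul_apply, ih (by omega), regular_x]
    ext ⟨i, l⟩
    rw [regularX_apply, Pi.single_apply, Pi.single_apply]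
    by_cases hl : (l : ℕ) = 0
    · simp [hl, Prod.ext_iff, Fin.ext_iff]
    · by_cases hi : i = 0
      · have : (l : ℕ) - 1 = j ↔ (l : ℕ) = j + 1 := by omega
        simp [hl, hi, Prod.ext_iff, Fin.ext_iff, this]
      · simp [hi, Prod.ext_iff]

/-- The family `g⁻ⁱ xʲ`. -/
noncomputable def monomial (p : ZMod n × Fin n) : TaftAlgebra hω :=
  gInv hω ^ p.1.val * x hω ^ (p.2 : ℕ)

lemma gInv_pow_mod (m : ℕ) : gInv hω ^ (m % n) = gInv hω ^ m := by
  conv_rhs => rw [← Nat.div_add_mod m n, pow_add, pow_mul, gInv_pow, one_pow, one_mul]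

lemma gInv_pow_zmod_val [NeZero n] {m : ℕ} {i : ZMod n} (h : (m : ZMod n) = i) :
    gInv hω ^ i.val = gInv hω ^ m := by
  rw [← h, ZMod.val_natCast, gInv_pow_mod]

lemma linearIndependent_monomial [NeZero n] : LinearIndependent k (monomial hω) := by
  -- The vector at `(0, 0)` plays the role of `1`: the monomials send it to the standard basis.
  let ev : TaftAlgebra hω →ₗ[k] (ZMod n × Fin n → k) :=
    LinearMap.applyₗ (Pi.single (0, 0) 1) ∘ₗ (regular hω).toLinearMap
  refine LinearIndependent.of_comp ev ?_
  have h : ev ∘ monomial hω = Pi.basisFun k (ZMod n × Fin n) := by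
    ext1 p
    change regular hω (monomial hω p) (Pi.single (0, 0) 1) = _
    rw [monomial, map_mul, Module.End.mul_apply, regular_x_pow_single hω _ p.2.2,
      regular_gInv_pow_single]
    simp
  rw [h]
  exact (Pi.basisFun k _).linearIndependent

lemma gInv_pow_mul_x_pow_mem_span [NeZero n] (i j : ℕ) :
    gInv hω ^ i * x hω ^ j ∈ Submodule.span k (Set.range (monomial hω)) := by
  by_cases hj : j < n
  · refine Submodule.subset_span ⟨((i : ZMod n), ⟨j, hj⟩), ?_⟩
    rw [monomial, gInv_pow_zmod_val hω rfl]
  · rw [pow_eq_zero_of_le (by omega) (x_pow hω), mul_zero]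
    exact Submodule.zero_mem _

lemma x_mul_gInv_pow [NeZero n] (i : ℕ) :
    x hω * gInv hω ^ i = (ω⁻¹) ^ i • (gInv hω ^ i * x hω) := by
  refine mul_pow_comm ?_ i
  rw [gInv_mul_x, smul_smul, inv_mul_cancel₀ (hω.ne_zero (NeZero.ne n)), one_smul]

lemma g_eq_gInv_pow [NeZero n] : g hω = gInv hω ^ (n - 1) := by
  refine (left_inv_eq_right_inv (a := gInv hω) ?_ (gInv_mul_g hω)).symm
  rw [← pow_succ, Nat.sub_add_cancel NeZero.one_le, gInv_pow]

lemma span_monomial [NeZero n] : ⊤ ≤ Submodule.span k (Set.range (monomial hω)) := by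
  -- The span is a left ideal, and it contains `1`.
  have key (a : TaftAlgebra hω) : ∀ b ∈ Submodule.span k (Set.range (monomial hω)),
      a * b ∈ Submodule.span k (Set.range (monomial hω)) := by
    induction a using induction with
    | halg r =>
      intro b hb
      rw [← Algebra.smul_def]
      exact Submodule.smul_mem _ _ hb
    | hg =>
      intro b hb
      induction hb using Submodule.span_induction with
      | mem _ hy =>
        obtain ⟨p, rfl⟩ := hy
        rw [monomial, g_eq_gInv_pow, ← mul_assoc, ← pow_add]
        exact gInv_pow_mul_x_pow_mem_span hω _ _
      | zero => simp
      | add _ _ _ _ h1 h2 => rw [mul_add]; exact Submodule.add_mem _ h1 h2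
      | smul c _ _ h => rw [mul_smul_comm]; exact Submodule.smul_mem _ c h
    | hx =>
      intro b hb
      induction hb using Submodule.span_induction with
      | mem _ hy =>
        obtain ⟨p, rfl⟩ := hy
        rw [monomial, ← mul_assoc, x_mul_gInv_pow, smul_mul_assoc, mul_assoc, ← pow_succ']
        exact Submodule.smul_mem _ _ (gInv_pow_mul_x_pow_mem_span hω _ _)
      | zero => simp
      | add _ _ _ _ h1 h2 => rw [mul_add]; exact Submodule.add_mem _ h1 h2
      | smul c _ _ h => rw [mul_smul_comm]; exact Submodule.smul_mem _ c h
    | hmul a b ha hb => intro c hc; rw [mul_assoc]; exact ha _ (hb _ hc)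
    | hadd a b ha hb => intro c hc; rw [add_mul]; exact Submodule.add_mem _ (ha _ hc) (hb _ hc)
  intro a _
  have h1 := gInv_pow_mul_x_pow_mem_span hω 0 0
  simpa using key a _ h1

/-- The basis `g⁻ⁱ xʲ` of the Taft algebra. -/
noncomputable def monomialBasis [NeZero n] : Module.Basis (ZMod n × Fin n) k (TaftAlgebra hω) :=
  Module.Basis.mk (linearIndependent_monomial hω) (span_monomial hω)

lemma monomialBasis_apply [NeZero n] (p : ZMod n × Fin n) :
    monomialBasis hω p = monomial hω p := by
  simp [monomialBasis]

end Basis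

/-! ### The trace of the antipode. -/

/-- Collecting the factors `g⁻¹` on the left costs `ω⁻¹` per crossing, and there are `0 + 1 + ⋯ + (j
- 1)` crossings. -/
lemma gInv_mul_x_pow [NeZero n] (j : ℕ) :
    (gInv hω * x hω) ^ j = (ω ^ j.choose 2)⁻¹ • (gInv hω ^ j * x hω ^ j) := by
  induction j with
  | zero => simp
  | succ j ih =>
    rw [pow_succ', ih, mul_smul_comm, mul_assoc, ← mul_assoc (x hω), x_mul_gInv_pow,
      smul_mul_assoc, mul_smul_comm, mul_assoc, ← pow_succ', ← mul_assoc, ← pow_succ', smul_smul,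
      Nat.choose_succ_succ' j 1, Nat.choose_one_right, pow_add ω, mul_inv, inv_pow,
      mul_comm (ω ^ j)⁻¹]

/-- The bound `hi` makes the truncated `n - i` an honest exponent, with `gⁱ = g⁻⁽ⁿ⁻ⁱ⁾`; moving `gⁱ`
left past `xʲ` gives `ω ^ (i * j)`. -/
lemma antipode_gInv_pow_mul_x_pow [NeZero n] (i j : ℕ) (hi : i ≤ n) :
    antipode k (gInv hω ^ i * x hω ^ j) =
      ((-1) ^ j * (ω ^ j.choose 2)⁻¹ * ω ^ (i * j)) •
        (gInv hω ^ (j + (n - i)) * x hω ^ j) := by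
  have hpow (a : TaftAlgebra hω) (m : ℕ) : antipode k (a ^ m) = antipode k a ^ m := by
    induction m with
    | zero => simp
    | succ m ih => rw [pow_succ', antipode_mul_antidistrib, ih, pow_succ]
  have hg : g hω ^ i = gInv hω ^ (n - i) := by
    refine (left_inv_eq_right_inv (a := gInv hω ^ i) ?_ ?_).symm
    · rw [← pow_add, Nat.sub_add_cancel hi, gInv_pow]
    · rw [← (show Commute (gInv hω) (g hω) from
        (gInv_mul_g hω).trans (g_mul_gInv hω).symm).mul_pow, gInv_mul_g, one_pow]
  have hx (m : ℕ) : x hω ^ m * g hω ^ i = ω ^ (i * m) • (g hω ^ i * x hω ^ m) := by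
    induction m with
    | zero => simp
    | succ m ih =>
      rw [pow_succ', mul_assoc, ih, mul_smul_comm, ← mul_assoc, mul_pow_comm (x_mul_g hω),
        smul_mul_assoc, smul_smul, mul_assoc, ← pow_succ', ← pow_add, Nat.mul_succ]
  rw [antipode_mul_antidistrib, hpow, hpow, antipode_gInv, antipode_x, neg_pow, gInv_mul_x_pow,
    mul_smul_comm, smul_mul_assoc, mul_assoc, mul_assoc, hx, mul_smul_comm, mul_smul_comm, hg,
    ← mul_assoc (gInv hω ^ j), ← pow_add, smul_smul, mul_comm _ (ω ^ (i * j))]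
  have h1 : ((-1 : TaftAlgebra hω) ^ j) = ((-1 : k) ^ j) • (1 : TaftAlgebra hω) := by
    rw [← Algebra.algebraMap_eq_smul_one]; simp
  rw [h1, smul_mul_assoc, one_mul, smul_smul]
  congr 1
  ring

/-- The diagonal coefficients of the antipode in the basis `g⁻ⁱ xʲ`. -/
lemma antipode_coeff [NeZero n] {ω : k} (hω : IsPrimitiveRoot ω n) (i : ℕ) (hi : i < n)
    (j : ℕ) (hj : j < n)
    (hij : (j : ZMod n) = 2 * i) :
    (-1) ^ j * (ω ^ j.choose 2)⁻¹ * ω ^ (i * j) = if 2 * i < n then ω ^ i else -ω ^ i := by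
  have hω0 : ω ≠ 0 := hω.ne_zero (NeZero.ne n)
  have hmod : j = 2 * i % n := by
    have h := congrArg ZMod.val hij
    rwa [← Nat.cast_ofNat, ← Nat.cast_mul, ZMod.val_natCast, ZMod.val_natCast,
      Nat.mod_eq_of_lt hj] at h
  rw [mul_right_comm, ← div_eq_mul_inv, div_eq_iff (pow_ne_zero _ hω0)]
  split_ifs with h2i
  -- Here the exponent of `ω` is `2i² - i(2i - 1) = i`.
  · obtain rfl : j = 2 * i := by rwa [Nat.mod_eq_of_lt h2i] at hmod
    rw [pow_mul (-1 : k), neg_one_sq, one_pow, one_mul, ← pow_add]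
    congr 1
    rw [Nat.choose_two_right, mul_assoc 2 i, Nat.mul_div_cancel_left _ two_pos]
    obtain _ | i := i
    · rfl
    · rw [show 2 * (i + 1) - 1 = 2 * i + 1 by omega]
      ring
  · have hj2 : 2 * i = j + n := by
      rw [Nat.mod_eq_sub_mod (by omega), Nat.mod_eq_of_lt (by omega)] at hmod
      omega
    have hT : j.choose 2 * 2 + j = j * j := by
      rw [Nat.choose_two_right, ← Finset.sum_range_id, Finset.sum_range_id_mul_two]
      obtain _ | j := j
      · rfl
      · rw [Nat.add_sub_cancel]; ring
    -- Now `j = 2i - n`. For even `n` the minus sign comes from `ω ^ (n/2) = -1`, for odd `n` from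
    -- `(-1) ^ j` with `j` odd.
    obtain ⟨r, rfl | rfl⟩ := Nat.even_or_odd' n
    · obtain ⟨s, rfl⟩ : ∃ s, i = r + s := Nat.exists_eq_add_of_le (by omega)
      obtain rfl : j = 2 * s := by omega
      have hr : ω ^ r = -1 := (hω.pow (by omega) (mul_comm 2 r)).eq_neg_one_of_two_right
      rw [pow_mul (-1 : k), neg_one_sq, one_pow, one_mul, pow_add, hr, neg_one_mul, neg_neg,
        ← pow_add, show (r + s) * (2 * s) = 2 * r * s + (s + (2 * s).choose 2) by nlinarith,
        pow_add, pow_mul, hω.pow_eq_one, one_pow, one_mul]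
    · obtain ⟨s, rfl⟩ : ∃ s, j = 2 * s + 1 := ⟨(j - 1) / 2, by omega⟩
      obtain rfl : i = r + s + 1 := by omega
      rw [(odd_two_mul_add_one s).neg_one_pow, neg_one_mul, neg_mul, neg_inj, ← pow_add,
        show (r + s + 1) * (2 * s + 1) = (2 * r + 1) * s + (r + s + 1 + (2 * s + 1).choose 2) by
          nlinarith,
        pow_add, pow_mul, hω.pow_eq_one, one_pow, one_mul]

/-- The antipode maps `g⁻ⁱ xʲ` to a multiple of `g⁻⁽ʲ⁻ⁱ⁾ xʲ`, which is diagonal exactly when `j ≡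
2i` modulo `n`. Each `i` thus contributes one `j`. -/
lemma trace_antipode [NeZero n] :
    LinearMap.trace k (TaftAlgebra hω) (antipode k) =
      ∑ i ∈ Finset.range n, if 2 * i < n then ω ^ i else -ω ^ i := by
  rw [LinearMap.trace_eq_matrix_trace k (monomialBasis hω), Matrix.trace]
  have hdiag (p : ZMod n × Fin n) :
      (LinearMap.toMatrix (monomialBasis hω) (monomialBasis hω) (antipode k)).diag p =
        if p.2 = Fin.ofNat n (2 * p.1.val) then
          (if 2 * p.1.val < n then ω ^ p.1.val else -ω ^ p.1.val) else 0 := by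
    obtain ⟨i, j⟩ := p
    have hS : antipode k (monomial hω (i, j)) =
        ((-1) ^ (j : ℕ) * (ω ^ (j : ℕ).choose 2)⁻¹ * ω ^ (i.val * j)) •
          monomialBasis hω ((j : ℕ) - i, j) := by
      rw [monomial, antipode_gInv_pow_mul_x_pow hω _ _ i.val_lt.le, monomialBasis_apply, monomial,
        gInv_pow_zmod_val hω (m := j + (n - i.val))]
      rw [Nat.cast_add, Nat.cast_sub i.val_lt.le]
      simp [sub_eq_add_neg]
    have hiff : ((j : ℕ) - i : ZMod n) = i ↔ j = Fin.ofNat n (2 * i.val) := by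
      rw [sub_eq_iff_eq_add, ← two_mul, Fin.ext_iff, Fin.val_ofNat]
      constructor
      · intro h
        rw [← ZMod.val_natCast, Nat.cast_mul, ZMod.natCast_zmod_val, Nat.cast_ofNat, ← h,
          ZMod.val_natCast, Nat.mod_eq_of_lt j.2]
      · intro h
        rw [h, ZMod.natCast_mod, Nat.cast_mul, ZMod.natCast_zmod_val, Nat.cast_ofNat]
    rw [Matrix.diag_apply, LinearMap.toMatrix_apply, monomialBasis_apply, hS, map_smul,
      Module.Basis.repr_self, Finsupp.smul_apply, Finsupp.single_apply]
    simp only [Prod.mk.injEq, and_true, hiff]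
    split_ifs with h1 h2
    all_goals simp only [smul_eq_mul, mul_one, mul_zero]
    all_goals
      rw [antipode_coeff hω i.val i.val_lt j j.2
        (by rw [ZMod.natCast_zmod_val, two_mul, ← sub_eq_iff_eq_add]; exact hiff.mpr h1)]
      simp [*]
  simp_rw [hdiag]
  rw [Fintype.sum_prod_type]
  simp only [Finset.sum_ite_eq', Finset.mem_univ, if_true]
  refine Finset.sum_nbij' ZMod.val (fun m => (m : ZMod n)) ?_ ?_ ?_ ?_ ?_
  · intro i _; simpa using i.val_lt
  · simp
  · simp
  · intro m hm; exact ZMod.val_natCast_of_lt (by simpa using hm)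
  · simp

/-- Adding `∑ ωⁱ = 0` to the signed sum doubles the terms with a plus sign, those with `i < ⌈n/2⌉`,
and cancels the others. What remains is a geometric sum. -/
lemma one_sub_mul_trace_antipode [NeZero n] (hn : 2 ≤ n) :
    (1 - ω) * LinearMap.trace k (TaftAlgebra hω) (antipode k) =
      2 * (1 - ω ^ ((n + 1) / 2)) := by
  have h1 (i : ℕ) : (if 2 * i < n then ω ^ i else -ω ^ i) =
      2 * (if 2 * i < n then ω ^ i else 0) - ω ^ i := by
    split_ifs <;> ring
  have h2 : (Finset.range n).filter (fun i => 2 * i < n) = Finset.range ((n + 1) / 2) := by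
    ext i
    simp only [Finset.mem_filter, Finset.mem_range]
    omega
  rw [trace_antipode]
  simp_rw [h1]
  rw [Finset.sum_sub_distrib, hω.geom_sum_eq_zero (by omega), sub_zero, ← Finset.mul_sum,
    ← Finset.sum_filter, h2, mul_left_comm, mul_neg_geom_sum]

/-- For even `n`, `ω ^ (n/2) = -1` gives `(1 - ω) t = 4` for the trace `t`. For odd `n`, `ω ^
((n+1)/2)` is a square root `η` of `ω`, and cancelling `1 - η` gives `(1 + η) t = 2`. As `2 ≠ 0` in
`k`, `t` is nonzero and determines `ω`. -/
lemma trace_antipode_injective [CharZero k] [NeZero n] {ω' : k} (hω' : IsPrimitiveRoot ω' n)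
    (h : LinearMap.trace k (TaftAlgebra hω) (antipode k) =
      LinearMap.trace k (TaftAlgebra hω') (antipode k)) : ω = ω' := by
  obtain hn | hn : n = 1 ∨ 2 ≤ n := by have := NeZero.ne n; omega
  · subst hn
    rw [IsPrimitiveRoot.one_right_iff] at hω hω'
    rw [hω, hω']
  have h1 := one_sub_mul_trace_antipode hω hn
  have h2 := one_sub_mul_trace_antipode hω' hn
  rw [h] at h1
  generalize LinearMap.trace k (TaftAlgebra hω') (antipode k) = t at h1 h2
  obtain ⟨r, rfl | rfl⟩ := Nat.even_or_odd' n
  · have hr {ζ : k} (hζ : IsPrimitiveRoot ζ (2 * r)) : ζ ^ ((2 * r + 1) / 2) = -1 := by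
      rw [show (2 * r + 1) / 2 = r by omega]
      exact (hζ.pow (by omega) (mul_comm 2 r)).eq_neg_one_of_two_right
    rw [hr hω] at h1
    rw [hr hω'] at h2
    have ht : t ≠ 0 := by
      rintro rfl
      norm_num at h1
    have h3 : (1 - ω) * t = (1 - ω') * t := h1.trans h2.symm
    linear_combination -mul_right_cancel₀ ht h3
  · have key {ζ : k} (hζ : IsPrimitiveRoot ζ (2 * r + 1))
        (ht : (1 - ζ) * t = 2 * (1 - ζ ^ ((2 * r + 1 + 1) / 2))) :
        (ζ ^ (r + 1)) ^ 2 = ζ ∧ (1 + ζ ^ (r + 1)) * t = 2 := by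
      have hsq : (ζ ^ (r + 1)) ^ 2 = ζ := by
        rw [← pow_mul, show (r + 1) * 2 = (2 * r + 1) + 1 by ring, pow_succ, hζ.pow_eq_one, one_mul]
      refine ⟨hsq, ?_⟩
      rw [show (2 * r + 1 + 1) / 2 = r + 1 by omega] at ht
      have hne : 1 - ζ ^ (r + 1) ≠ 0 :=
        sub_ne_zero.mpr (hζ.pow_ne_one_of_pos_of_lt (by omega) (by omega)).symm
      refine mul_left_cancel₀ hne ?_
      linear_combination ht - t * hsq
    obtain ⟨h3, h4⟩ := key hω h1
    obtain ⟨h5, h6⟩ := key hω' h2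
    have ht : t ≠ 0 := by
      rintro rfl
      norm_num at h4
    have h7 : 1 + ω ^ (r + 1) = 1 + ω' ^ (r + 1) := mul_right_cancel₀ ht (h4.trans h6.symm)
    rw [← h3, ← h5, add_left_cancel h7]

end TaftAlgebra

theorem corollary3p3 {k : Type*} [Field k] [IsAlgClosed k] [CharZero k] {n : ℕ} [NeZero n]
    {ω₁ ω₂ : k} (hω₁ : IsPrimitiveRoot ω₁ n) (hω₂ : IsPrimitiveRoot ω₂ n) :
    (LinearMap.trace k (TaftAlgebra hω₁) (HopfAlgebra.antipode k) =
        LinearMap.trace k (TaftAlgebra hω₂) (HopfAlgebra.antipode k) ↔ ω₁ = ω₂) ∧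
      (GaugeEquivalent k (TaftAlgebra hω₁) (TaftAlgebra hω₂) ↔ ω₁ = ω₂) := by
  refine ⟨⟨TaftAlgebra.trace_antipode_injective hω₁ hω₂, ?_⟩,
    ⟨TaftAlgebra.eq_of_gaugeEquivalent, ?_⟩⟩
  · rintro rfl
    rfl
  · rintro rfl
    exact GaugeEquivalent.refl k _
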